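/- Operators on $\mathbb{C}^m\otimes\mathbb{C}^n$ are considered with respect to the computational bases $|0\rangle,|1\rangle,\dots$. A Hermitian operator $W$ on $\mathbb{C}^m\otimes\mathbb{C}^n$ is an entanglement witness if $\langle\psi\otimes\varphi|W|\psi\otimes\varphi\rangle\ge 0$ for all $\psi\in\mathbb{C}^m$, $\varphi\in\mathbb{C}^n$, but $W$ is not positive semidefinite. It detects the set $\mathcal{D}_W$ of all states (positive semidefinite operators $\rho$ of trace one) with $\mathrm{Tr}(W\rho)<0$. An entanglement witness $W$ is optimal if there is no entanglement witness $W'$ with $\mathcal{D}_W\subsetneq\mathcal{D}_{W'}$. $W$ has the spanning property if the product vectors $\psi\otimes\varphi$ with $\langle\psi\otimes\varphi|W|\psi\otimes\varphi\rangle=0$ span $\mathbb{C}^m\otimes\mathbb{C}^n$. For $\theta\in[0,\pi]$ put $$\alpha_0=\tfrac12(2-\sin\theta),\quad \alpha_1=\tfrac12(1+\cos\theta),\quad \alpha_2=2-\alpha_0,\quad \alpha_3=1-\alpha_1,$$ and define on $\mathbb{C}^4\otimes\mathbb{C}^4$ the operator $$W_I(\theta)=\sum_{k,l=0}^{3}\alpha_{k-l}\,|k\rangle\langle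 k|\otimes|l\rangle\langle l|-\sum_{k\ne l}|k\rangle\langle l|\otimes|k\rangle\langle l|,$$ with indices of $\alpha$ modulo $4$, and $P=|\Psi\rangle\langle\Psi|$ with $\Psi=\tfrac12\sum_{j=0}^{3}(-1)^{j+1}|j\otimes j\rangle$. **Theorem.** Let $\theta\in[0,\pi]$. 1. For every $\lambda\in\mathbb{R}$, the operator $W_I(\theta)-\lambda P$ is an entanglement witness if and only if $\lambda\le 2$. 2. The entanglement witness $W_I(\theta)-2P$ is optimal. 3. The entanglement witness $W_I(\theta)$ is not optimal. 4. If $\theta\in(0,\pi)$, then $W_I(\theta)-2P$ has the spanning property. -/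

import Mathlib

open scoped ComplexOrder Kronecker Matrix

noncomputable section

namespace BellWitness

section General

variable {m n : Type*} [Fintype m] [Fintype n]

/-- The product vector `ψ ⊗ φ` in `ℂ^m ⊗ ℂ^n`; operators on `ℂ^m ⊗ ℂ^n` are matrices indexed
by `m × n`. -/
def prodVec (ψ : m → ℂ) (φ : n → ℂ) : m × n → ℂ := fun p => ψ p.1 * φ p.2

/-- The expectation value `⟨v|W|v⟩`. -/
def expVal {ι : Type*} [Fintype ι] (W : Matrix ι ι ℂ) (v : ι → ℂ) : ℂ := star v ⬝ᵥ (W *ᵥ v)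

/-- An entanglement witness: a Hermitian operator that is nonnegative on all product vectors but
not positive semidefinite. (For Hermitian `W` the expectation values are real.) -/
def IsEntanglementWitness (W : Matrix (m × n) (m × n) ℂ) : Prop :=
  W.IsHermitian ∧ (∀ (ψ : m → ℂ) (φ : n → ℂ), 0 ≤ (expVal W (prodVec ψ φ)).re) ∧ ¬ W.PosSemidef

/-- A state: a density operator. -/
def IsState {ι : Type*} [Fintype ι] (ρ : Matrix ι ι ℂ) : Prop := ρ.PosSemidef ∧ ρ.trace = 1

/-- The set of states detected by `W`, i.e. the states `ρ` with `Tr (W ρ) < 0`.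
(For Hermitian `W` this trace is real.) -/
def detected (W : Matrix (m × n) (m × n) ℂ) : Set (Matrix (m × n) (m × n) ℂ) :=
  {ρ | IsState ρ ∧ (W * ρ).trace.re < 0}

/-- An optimal entanglement witness: an entanglement witness such that no entanglement witness
detects a strictly larger set of states. -/
def IsOptimalWitness (W : Matrix (m × n) (m × n) ℂ) : Prop :=
  IsEntanglementWitness W ∧
    ∀ W' : Matrix (m × n) (m × n) ℂ, IsEntanglementWitness W' → ¬ (detected W ⊂ detected W')

/-- The spanning property: the product vectors with vanishing expectation value span the whole
space `ℂ^m ⊗ ℂ^n`. -/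
def HasSpanningProperty (W : Matrix (m × n) (m × n) ℂ) : Prop :=
  Submodule.span ℂ {v : m × n → ℂ | ∃ (ψ : m → ℂ) (φ : n → ℂ),
    v = prodVec ψ φ ∧ expVal W v = 0} = ⊤

end General

/-- The operator `∑_{k,l} α_{k-l} |k⟩⟨k| ⊗ |l⟩⟨l| - ∑_{k ≠ l} |k⟩⟨l| ⊗ |k⟩⟨l|` on `ℂ⁴ ⊗ ℂ⁴`,
where `α = (a, b, c, d)` and `k - l` is taken modulo 4. -/
def circulantOp (a b c d : ℝ) : Matrix (Fin 4 × Fin 4) (Fin 4 × Fin 4) ℂ :=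
  (∑ k : Fin 4, ∑ l : Fin 4, ((![a, b, c, d] (k - l) : ℝ) : ℂ) •
      (Matrix.single k k (1 : ℂ) ⊗ₖ Matrix.single l l (1 : ℂ))) -
    ∑ k : Fin 4, ∑ l : Fin 4,
      if k ≠ l then Matrix.single k l (1 : ℂ) ⊗ₖ Matrix.single k l (1 : ℂ) else 0

/-- The class-I operator `W_I(θ)`, with `a = (2 - sin θ)/2`, `b = (1 + cos θ)/2`, `c = 2 - a`,
`d = 1 - b`. -/
def witnessI (θ : ℝ) : Matrix (Fin 4 × Fin 4) (Fin 4 × Fin 4) ℂ :=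
  circulantOp ((2 - Real.sin θ) / 2) ((1 + Real.cos θ) / 2)
    (2 - (2 - Real.sin θ) / 2) (1 - (1 + Real.cos θ) / 2)

/-- The vector `Ψ = ½ ∑_j (-1)^{j+1} |j ⊗ j⟩`. -/
def bigPsi : Fin 4 × Fin 4 → ℂ :=
  fun p => if p.1 = p.2 then (1 / 2 : ℂ) * (-1) ^ ((p.1 : ℕ) + 1) else 0

/-- The projector `P = |Ψ⟩⟨Ψ|`. -/
def projPsi : Matrix (Fin 4 × Fin 4) (Fin 4 × Fin 4) ℂ := Matrix.vecMulVec bigPsi (star bigPsi)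

end BellWitness

end

noncomputable section

namespace BellWitness

/-! Block positivity of W_I(θ) - 2P: on a product vector the subtracted terms are largest when the
phases align, so only the moduli `r`, `q` matter. What remains is affine in (sin θ, cos θ), and
Cauchy-Schwarz reduces it to the θ-free inequality `discriminant_le`. The threshold 2 is sharp
because one product vector has expectation 2 - λ. Zeros of W = W_I(θ) - 2P: the vectors ψ ⊗ ψ̄ with
|ψ₀| = |ψ₂|, |ψ₁| = |ψ₃| span all |kl⟩ with k ≠ l, together with |00⟩ + |22⟩ and |11⟩ + |33⟩. The
two missing dimensions come from "edge" vectors with expectation (C y² - S x²)², where C = cos(θ/2),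
S = sin(θ/2); for 0 < θ < π these have zeros with xy ≠ 0. Optimality: if W' detects all that W
detects, then Q = λW - W' ≥ 0 for some λ ≥ 0 (`exists_posSemidef_smul_sub`). As Q ≤ λW on product
vectors, Q kills the zeros of W. At θ = 0, π the edge zeros degenerate and a limit replaces them
(`eq_zero_of_forall_mul_le`). Hence Q = 0, and W' detects nothing new. -/

/-! ### Real inequalities for the moduli. -/

lemma discriminant_le (r0 r1 r2 r3 q0 q1 q2 q3 : ℝ) :
    ((r0 ^ 2 - r2 ^ 2) * (q1 ^ 2 - q3 ^ 2) - (r1 ^ 2 - r3 ^ 2) * (q0 ^ 2 - q2 ^ 2)) ^ 2 ≤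
      (3 * ((r0 * q2 - r2 * q0) ^ 2 + (r1 * q3 - r3 * q1) ^ 2) +
        ((r0 * q1 - q0 * r1) ^ 2 + (r0 * q3 - q0 * r3) ^ 2 + (r2 * q1 - q2 * r1) ^ 2 +
          (r2 * q3 - q2 * r3) ^ 2)) *
      ((r0 * q2 - r2 * q0) ^ 2 + (r1 * q3 - r3 * q1) ^ 2 +
        2 * ((r0 * q0 - r2 * q2) ^ 2 + (r1 * q1 - r3 * q3) ^ 2) +
        ((r0 * q1 - q0 * r1) ^ 2 + (r0 * q3 - q0 * r3) ^ 2 + (r2 * q1 - q2 * r1) ^ 2 +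
          (r2 * q3 - q2 * r3) ^ 2)) := by
  -- Lagrange's identity bounds the first square by `4 * (D0 ^ 2 + D1 ^ 2) * (S0 ^ 2 + S1 ^ 2)`;
  -- AM-GM handles the terms in `h`.
  have key : ∀ D0 D1 S0 S1 h M : ℝ, 0 ≤ M → |h| ≤ M →
      4 * (D0 * S1 - S0 * D1) ^ 2 + h * (4 * (S0 * S1 - D0 * D1) + h) ≤
        (3 * (D0 ^ 2 + D1 ^ 2) + M) * (D0 ^ 2 + D1 ^ 2 + 2 * (S0 ^ 2 + S1 ^ 2) + M) := by
    intro D0 D1 S0 S1 h M hM hh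
    have h1 : h ^ 2 ≤ M ^ 2 := sq_le_sq' (abs_le.1 hh).1 (abs_le.1 hh).2
    have h2 : h * (4 * (S0 * S1 - D0 * D1)) ≤ M * (2 * (S0 ^ 2 + S1 ^ 2 + D0 ^ 2 + D1 ^ 2)) := by
      refine (le_abs_self _).trans ?_
      rw [abs_mul]
      refine mul_le_mul hh ?_ (abs_nonneg _) hM
      rw [abs_le]
      constructor <;>
        nlinarith [sq_nonneg (S0 - S1), sq_nonneg (S0 + S1), sq_nonneg (D0 - D1),
          sq_nonneg (D0 + D1)]
    have h3 : 0 ≤ M * (D0 ^ 2 + D1 ^ 2) := by positivity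
    have h4 : 0 ≤ (D0 ^ 2 + D1 ^ 2) * (S0 ^ 2 + S1 ^ 2) := by positivity
    nlinarith [sq_nonneg (D0 * S0 + D1 * S1), sq_nonneg (D0 ^ 2 + D1 ^ 2)]
  -- With `h = al * be` the left side of `key` is exactly the square to be bounded. Changing the
  -- signs of `r3` and `q3` preserves that square and `M`, negates `D1` and turns `al`, `be` into
  -- `ga`, `de`: a second representation. As `4 * M` is the sum of the four squares, one of the two
  -- products is small enough.
  set al := (r0 + r2) * (q1 + q3) - (q0 + q2) * (r1 + r3) with hal
  set be := (r0 - r2) * (q1 - q3) - (q0 - q2) * (r1 - r3) with hbe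
  set ga := (r0 + r2) * (q1 - q3) - (q0 + q2) * (r1 - r3) with hga
  set de := (r0 - r2) * (q1 + q3) - (q0 - q2) * (r1 + r3) with hde
  set M := (r0 * q1 - q0 * r1) ^ 2 + (r0 * q3 - q0 * r3) ^ 2 + (r2 * q1 - q2 * r1) ^ 2 +
          (r2 * q3 - q2 * r3) ^ 2 with hM
  have hM0 : 0 ≤ M := by positivity
  have hM4 : 4 * M = al ^ 2 + be ^ 2 + ga ^ 2 + de ^ 2 := by
    rw [hM, hal, hbe, hga, hde]; ring
  have hor : |al * be| ≤ M ∨ |ga * de| ≤ M := by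
    have h1 : 2 * |al * be| ≤ al ^ 2 + be ^ 2 := by
      rw [abs_mul, ← sq_abs al, ← sq_abs be]; nlinarith [sq_nonneg (|al| - |be|)]
    have h2 : 2 * |ga * de| ≤ ga ^ 2 + de ^ 2 := by
      rw [abs_mul, ← sq_abs ga, ← sq_abs de]; nlinarith [sq_nonneg (|ga| - |de|)]
    by_contra! hc
    linarith [hc.1, hc.2]
  rcases hor with h | h
  · refine le_trans (le_of_eq ?_) (key (r0 * q2 - r2 * q0) (r1 * q3 - r3 * q1)
      (r0 * q0 - r2 * q2) (r1 * q1 - r3 * q3) (al * be) M hM0 h)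
    rw [hal, hbe]; ring
  · have := key (r0 * q2 - r2 * q0) (-(r1 * q3 - r3 * q1))
      (r0 * q0 - r2 * q2) (r1 * q1 - r3 * q3) (ga * de) M hM0 h
    rw [neg_sq] at this
    refine le_trans (le_of_eq ?_) this
    rw [hga, hde]; ring

/-- The block positivity of `W_I(θ) - 2P` in terms of the moduli of the two factors. -/
lemma circulant_form_ge (s c : ℝ) (hsc : s ^ 2 + c ^ 2 = 1) (r0 r1 r2 r3 q0 q1 q2 q3 : ℝ) :
    3 / 2 * (r0 * q0 + r2 * q2) ^ 2 + 3 / 2 * (r1 * q1 + r3 * q3) ^ 2 +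
        (r0 * q0 + r2 * q2) * (r1 * q1 + r3 * q3) ≤
      (2 - s / 2) * (r0 ^ 2 * q0 ^ 2 + r1 ^ 2 * q1 ^ 2 + r2 ^ 2 * q2 ^ 2 + r3 ^ 2 * q3 ^ 2) +
      (1 + c) / 2 * (r1 ^ 2 * q0 ^ 2 + r2 ^ 2 * q1 ^ 2 + r3 ^ 2 * q2 ^ 2 + r0 ^ 2 * q3 ^ 2) +
      (1 + s / 2) * (r2 ^ 2 * q0 ^ 2 + r3 ^ 2 * q1 ^ 2 + r0 ^ 2 * q2 ^ 2 + r1 ^ 2 * q3 ^ 2) +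
      (1 - c) / 2 * (r3 ^ 2 * q0 ^ 2 + r0 ^ 2 * q1 ^ 2 + r1 ^ 2 * q2 ^ 2 + r2 ^ 2 * q3 ^ 2) := by
  have hd := discriminant_le r0 r1 r2 r3 q0 q1 q2 q3
  set K := (r0 ^ 2 - r2 ^ 2) * (q1 ^ 2 - q3 ^ 2) - (r1 ^ 2 - r3 ^ 2) * (q0 ^ 2 - q2 ^ 2) with hK
  set D := (r0 * q2 - r2 * q0) ^ 2 + (r1 * q3 - r3 * q1) ^ 2 with hD
  set S := (r0 * q0 - r2 * q2) ^ 2 + (r1 * q1 - r3 * q3) ^ 2 with hS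
  set M := (r0 * q1 - q0 * r1) ^ 2 + (r0 * q3 - q0 * r3) ^ 2 + (r2 * q1 - q2 * r1) ^ 2 +
          (r2 * q3 - q2 * r3) ^ 2 with hM
  have hD0 : 0 ≤ D := by positivity
  have hS0 : 0 ≤ S := by positivity
  have hM0 : 0 ≤ M := by positivity
  clear_value K D S M
  have h1 : (s * (S - D) + c * K) ^ 2 ≤ (2 * D + S + M) ^ 2 := by
    -- A rotation preserves the norm of `(S - D, K)`; after `h3`, what is left is `discriminant_le`.
    have : (s * (S - D) + c * K) ^ 2 + (c * (S - D) - s * K) ^ 2 = (S - D) ^ 2 + K ^ 2 := by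
      linear_combination ((S - D) ^ 2 + K ^ 2) * hsc
    have h0 := sq_nonneg (c * (S - D) - s * K)
    have h3 : (2 * D + S + M) ^ 2 = (3 * D + M) * (D + 2 * S + M) + (S - D) ^ 2 := by ring
    rw [h3]
    linarith
  have h2 := (abs_le_of_sq_le_sq' h1 (by positivity)).2
  rw [← sub_nonneg]
  have : 0 ≤ ((2 * D + S + M) - (s * (S - D) + c * K)) / 2 := by linarith
  convert this using 1
  subst hD hS hM hK
  ring

/-! ### Comparing detected sets. -/

section General

variable {m n : Type*} [Fintype m] [Fintype n]

lemma expVal_sub {ι : Type*} [Fintype ι] (A B : Matrix ι ι ℂ) (v : ι → ℂ) :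
    expVal (A - B) v = expVal A v - expVal B v := by
  simp [expVal, Matrix.sub_mulVec, dotProduct_sub]

lemma expVal_smul {ι : Type*} [Fintype ι] (c : ℂ) (A : Matrix ι ι ℂ) (v : ι → ℂ) :
    expVal (c • A) v = c * expVal A v := by
  simp [expVal, Matrix.smul_mulVec]

lemma trace_mul_vecMulVec_star {ι : Type*} [Fintype ι] (A : Matrix ι ι ℂ) (v : ι → ℂ) :
    (A * Matrix.vecMulVec v (star v)).trace = expVal A v := by
  rw [Matrix.mul_vecMulVec, Matrix.trace_vecMulVec, expVal, dotProduct_comm]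

lemma expVal_im_eq_zero {ι : Type*} [Fintype ι] {A : Matrix ι ι ℂ} (hA : A.IsHermitian)
    (v : ι → ℂ) : (expVal A v).im = 0 := by
  have h : star (expVal A v) = expVal A v := by
    rw [expVal, ← Matrix.star_dotProduct, Matrix.star_mulVec, hA.eq, Matrix.dotProduct_mulVec]
  exact Complex.conj_eq_iff_im.1 h

lemma posSemidef_iff_expVal_re_nonneg {ι : Type*} [Fintype ι] {A : Matrix ι ι ℂ}
    (hA : A.IsHermitian) : A.PosSemidef ↔ ∀ v, 0 ≤ (expVal A v).re := by
  rw [Matrix.posSemidef_iff_dotProduct_mulVec]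
  refine ⟨fun h v => (Complex.le_def.1 (h.2 v)).1, fun h => ⟨hA, fun v => ?_⟩⟩
  exact Complex.le_def.2 ⟨h v, (expVal_im_eq_zero hA v).symm⟩

/-- Detection inequalities for states extend to the cone of positive semidefinite operators. -/
lemma trace_re_neg_of_detected_subset {W W' : Matrix (m × n) (m × n) ℂ}
    (h : detected W ⊆ detected W') {ρ : Matrix (m × n) (m × n) ℂ} (hρ : ρ.PosSemidef)
    (hW : (W * ρ).trace.re < 0) : (W' * ρ).trace.re < 0 := by
  have htr : ρ.trace ≠ 0 := fun h0 => by
    rw [hρ.trace_eq_zero_iff] at h0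
    simp [h0] at hW
  have h0 : 0 < ρ.trace := lt_of_le_of_ne hρ.trace_nonneg (Ne.symm htr)
  obtain ⟨hre, him⟩ := Complex.lt_def.1 h0
  have htr' : ρ.trace = ((ρ.trace.re : ℝ) : ℂ) := Complex.ext rfl (by simpa using him.symm)
  set t := ρ.trace.re with ht
  have ht0 : 0 < t := hre
  have hmul : ∀ A : Matrix (m × n) (m × n) ℂ,
      (A * (((t⁻¹ : ℝ) : ℂ) • ρ)).trace.re = t⁻¹ * (A * ρ).trace.re := fun A => by
    rw [Matrix.mul_smul, Matrix.trace_smul, smul_eq_mul, Complex.re_ofReal_mul]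
  have hmem : ((t⁻¹ : ℝ) : ℂ) • ρ ∈ detected W := by
    refine ⟨⟨hρ.smul (Complex.zero_le_real.2 (inv_nonneg.2 ht0.le)), ?_⟩, ?_⟩
    · rw [Matrix.trace_smul, htr', smul_eq_mul, ← Complex.ofReal_mul, inv_mul_cancel₀ ht0.ne',
        Complex.ofReal_one]
    · rw [hmul]; exact mul_neg_of_pos_of_neg (inv_pos.2 ht0) hW
  have := (h hmem).2
  rw [hmul] at this
  exact (pos_iff_neg_of_mul_neg this).1 (inv_pos.2 ht0)

/-- If `W'` detects every state detected by `W`, then `W'` is a nonnegative multiple of `W` minus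
a positive semidefinite operator. -/
theorem exists_posSemidef_smul_sub {W W' : Matrix (m × n) (m × n) ℂ}
    (hW : W.IsHermitian) (hW' : W'.IsHermitian) (hneg : ¬ W.PosSemidef)
    (h : detected W ⊆ detected W') :
    ∃ lam : ℝ, 0 ≤ lam ∧ ((lam : ℂ) • W - W').PosSemidef := by
  classical
  let f : Matrix (m × n) (m × n) ℂ → ℝ := fun ρ => (W * ρ).trace.re
  let g : Matrix (m × n) (m × n) ℂ → ℝ := fun ρ => (W' * ρ).trace.re
  have hadd : ∀ (A ρ σ : Matrix (m × n) (m × n) ℂ) (x y : ℝ),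
      (A * ((x : ℂ) • ρ + (y : ℂ) • σ)).trace.re
        = x * (A * ρ).trace.re + y * (A * σ).trace.re := fun A ρ σ x y => by
    rw [mul_add, Matrix.mul_smul, Matrix.mul_smul, Matrix.trace_add, Matrix.trace_smul,
      Matrix.trace_smul, smul_eq_mul, smul_eq_mul, Complex.add_re, Complex.re_ofReal_mul,
      Complex.re_ofReal_mul]
  have hpsd : ∀ (ρ σ : Matrix (m × n) (m × n) ℂ) (x y : ℝ), ρ.PosSemidef → σ.PosSemidef →
      0 ≤ x → 0 ≤ y → ((x : ℂ) • ρ + (y : ℂ) • σ).PosSemidef := fun ρ σ x y hρ hσ hx hy =>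
    (hρ.smul (Complex.zero_le_real.2 hx)).add (hσ.smul (Complex.zero_le_real.2 hy))
  have hfg : ∀ ρ, ρ.PosSemidef → f ρ < 0 → g ρ < 0 := fun ρ hρ hf =>
    trace_re_neg_of_detected_subset h hρ hf
  obtain ⟨v₁, hv₁⟩ : ∃ v, (expVal W v).re < 0 := by
    by_contra! hc
    exact hneg ((posSemidef_iff_expVal_re_nonneg hW).2 hc)
  set ρ₁ := Matrix.vecMulVec v₁ (star v₁) with hρ₁def
  have hρ₁ : ρ₁.PosSemidef := Matrix.posSemidef_vecMulVec_self_star v₁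
  have hf₁ : f ρ₁ < 0 := by
    change (W * ρ₁).trace.re < 0
    rwa [hρ₁def, trace_mul_vecMulVec_star]
  have hzero : ∀ ρ, ρ.PosSemidef → f ρ = 0 → g ρ ≤ 0 := by
    intro ρ hρ hf
    by_contra! hg
    have hg₁ := hfg ρ₁ hρ₁ hf₁
    -- The weight makes `g` vanish on the mixture while `f` is negative there, a contradiction.
    have h1 := hfg (((1 : ℝ) : ℂ) • ρ + ((g ρ / -g ρ₁ : ℝ) : ℂ) • ρ₁)
      (hpsd _ _ _ _ hρ hρ₁ zero_le_one (div_nonneg hg.le (by linarith))) (by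
        change (W * _).trace.re < 0
        rw [hadd]
        change 1 * f ρ + _ * f ρ₁ < 0
        rw [hf, mul_zero, zero_add]
        exact mul_neg_of_pos_of_neg (div_pos hg (by linarith)) hf₁)
    change (W' * _).trace.re < 0 at h1
    rw [hadd] at h1
    change 1 * g ρ + g ρ / -g ρ₁ * g ρ₁ < 0 at h1
    have : g ρ / -g ρ₁ * g ρ₁ = - g ρ := by
      rw [div_neg, neg_mul, div_mul_cancel₀ _ hg₁.ne]
    linarith
  set R : Set ℝ := (fun ρ => g ρ / f ρ) '' {ρ | ρ.PosSemidef ∧ f ρ < 0} with hR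
  have hRne : R.Nonempty := ⟨_, ρ₁, ⟨hρ₁, hf₁⟩, rfl⟩
  have hR0 : ∀ x ∈ R, 0 ≤ x := by
    rintro _ ⟨ρ, ⟨hρ, hf⟩, rfl⟩
    exact div_nonneg_of_nonpos (hfg ρ hρ hf).le hf.le
  -- The multiplier must be at most every ratio with `f ρ < 0` and at least every ratio with `f ρ >
  -- 0`; the infimum of the former works once the two families are ordered.
  refine ⟨sInf R, Real.sInf_nonneg hR0, ?_⟩
  have hle : ∀ ρ, ρ.PosSemidef → g ρ ≤ sInf R * f ρ := by
    intro ρ hρ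
    rcases lt_trichotomy (f ρ) 0 with hf | hf | hf
    · have : sInf R ≤ g ρ / f ρ := csInf_le ⟨0, hR0⟩ ⟨ρ, ⟨hρ, hf⟩, rfl⟩
      rwa [le_div_iff_of_neg hf] at this
    · rw [hf, mul_zero]; exact hzero ρ hρ hf
    · rw [← div_le_iff₀ hf]
      refine le_csInf hRne ?_
      rintro _ ⟨σ, ⟨hσ, hfσ⟩, rfl⟩
      -- This positive combination cancels `f`, so `hzero` compares the two ratios.
      have h1 := hzero (((f ρ : ℝ) : ℂ) • σ + ((-f σ : ℝ) : ℂ) • ρ)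
        (hpsd _ _ _ _ hσ hρ hf.le (by linarith)) (by
          change (W * _).trace.re = 0
          rw [hadd]
          change f ρ * f σ + -f σ * f ρ = 0
          ring)
      change (W' * _).trace.re ≤ 0 at h1
      rw [hadd] at h1
      change f ρ * g σ + -f σ * g ρ ≤ 0 at h1
      change g ρ / f ρ ≤ g σ / f σ
      rw [le_div_iff_of_neg hfσ, div_mul_eq_mul_div, le_div_iff₀ hf]
      linarith
  have hH : (((sInf R : ℝ) : ℂ) • W - W').IsHermitian := by
    refine Matrix.IsHermitian.sub ?_ hW'
    rw [Matrix.IsHermitian, Matrix.conjTranspose_smul, hW.eq]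
    simp
  rw [posSemidef_iff_expVal_re_nonneg hH]
  intro v
  have h1 := hle _ (Matrix.posSemidef_vecMulVec_self_star v)
  change (W' * _).trace.re ≤ _ * (W * _).trace.re at h1
  rw [trace_mul_vecMulVec_star, trace_mul_vecMulVec_star] at h1
  rw [expVal_sub, expVal_smul, Complex.sub_re, Complex.re_ofReal_mul]
  linarith

end General

/-! ### Expectation values as explicit quadratic forms. -/

lemma circulantOp_apply (a b c d : ℝ) (p q : Fin 4 × Fin 4) :
    circulantOp a b c d p q =
      (if p = q then ((![a, b, c, d] (p.1 - p.2) : ℝ) : ℂ) else 0) -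
        if p.1 = p.2 ∧ q.1 = q.2 ∧ p.1 ≠ q.1 then 1 else 0 := by
  obtain ⟨k, l⟩ := p
  obtain ⟨k', l'⟩ := q
  simp only [circulantOp, Matrix.sub_apply, Matrix.sum_apply, Matrix.smul_apply,
    Matrix.kroneckerMap_apply]
  congr 1
  · rw [Finset.sum_eq_single k, Finset.sum_eq_single l]
    · by_cases h1 : k = k' <;> by_cases h2 : l = l' <;> simp [h1, h2]
    · intro j _ hj; simp [Matrix.single_apply, hj]
    · simp
    · intro j _ hj; simp [Matrix.single_apply, hj]
    · simp
  · rw [Finset.sum_eq_single k, Finset.sum_eq_single k']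
    · by_cases h0 : k = k'
      · simp [h0]
      · rw [if_pos h0, Matrix.kroneckerMap_apply]
        by_cases h1 : k = l <;> by_cases h2 : k' = l' <;> simp_all
    · intro j _ hj
      by_cases h0 : k = j <;> simp [h0, Matrix.single_apply, hj]
    · simp
    · intro j _ hj
      refine Finset.sum_eq_zero fun i _ => ?_
      by_cases h0 : j = i <;> simp [h0, Matrix.single_apply, hj]
    · simp

lemma expVal_circulantOp (a b c d : ℝ) (v : Fin 4 × Fin 4 → ℂ) :
    expVal (circulantOp a b c d) v =
      ((∑ k, ∑ l, ![a, b, c, d] (k - l) * Complex.normSq (v (k, l)) +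
        ∑ k, Complex.normSq (v (k, k)) - Complex.normSq (∑ k, v (k, k)) : ℝ) : ℂ) := by
  have h : ∀ p : Fin 4 × Fin 4, (circulantOp a b c d *ᵥ v) p =
      ((![a, b, c, d] (p.1 - p.2) : ℝ) : ℂ) * v p +
        if p.1 = p.2 then v p - ∑ j, v (j, j) else 0 := by
    rintro ⟨k, l⟩
    simp only [Matrix.mulVec, dotProduct, circulantOp_apply, sub_mul, Finset.sum_sub_distrib]
    have h1 : ∑ q : Fin 4 × Fin 4, (if (k, l) = q then ((![a, b, c, d] (k - l) : ℝ) : ℂ) else 0) *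
        v q = ((![a, b, c, d] (k - l) : ℝ) : ℂ) * v (k, l) := by
      simp only [ite_mul, zero_mul, Finset.sum_ite_eq, Finset.mem_univ, if_true]
    have h2 : ∑ q : Fin 4 × Fin 4, (if k = l ∧ q.1 = q.2 ∧ k ≠ q.1 then (1 : ℂ) else 0) * v q =
        if k = l then ∑ j, v (j, j) - v (k, l) else 0 := by
      rw [Fintype.sum_prod_type]
      split_ifs with hkl
      · subst hkl
        have : ∀ i : Fin 4, ∑ j : Fin 4,
            (if True ∧ i = j ∧ k ≠ i then (1 : ℂ) else 0) * v (i, j) =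
              v (i, i) - if k = i then v (i, i) else 0 := fun i => by
          rw [Finset.sum_eq_single i]
          · by_cases hki : k = i <;> simp [hki]
          · intro j _ hj; simp [hj.symm]
          · simp
        simp only [this, Finset.sum_sub_distrib, Finset.sum_ite_eq, Finset.mem_univ, if_true]
      · simp [hkl]
    rw [h1, h2]
    split_ifs <;> ring
  simp only [expVal, dotProduct, h, Pi.star_apply, mul_add, Finset.sum_add_distrib,
    Fintype.sum_prod_type, mul_ite, mul_zero, Finset.sum_ite_eq, Finset.mem_univ, if_true]
  push_cast
  simp only [Complex.normSq_eq_conj_mul_self, map_sum, Finset.sum_mul, mul_sub,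
    Finset.sum_sub_distrib, ← Complex.star_def]
  rw [add_sub_assoc]
  congr 1
  refine Finset.sum_congr rfl fun k _ => Finset.sum_congr rfl fun l _ => by ring

lemma expVal_projPsi (v : Fin 4 × Fin 4 → ℂ) :
    expVal projPsi v =
      ((Complex.normSq (v (0, 0) - v (1, 1) + v (2, 2) - v (3, 3)) / 4 : ℝ) : ℂ) := by
  have h : star bigPsi ⬝ᵥ v = - (v (0, 0) - v (1, 1) + v (2, 2) - v (3, 3)) / 2 := by
    simp [dotProduct, Fintype.sum_prod_type, bigPsi, Fin.sum_univ_four, Complex.conj_ofNat]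
    ring
  have h' : star v ⬝ᵥ bigPsi = star (star bigPsi ⬝ᵥ v) := by
    rw [← Matrix.star_dotProduct]
  rw [expVal, projPsi, Matrix.vecMulVec_mulVec, h]
  simp only [dotProduct_smul, h', h]
  push_cast
  rw [Complex.normSq_eq_conj_mul_self]
  simp
  ring

lemma expVal_witnessI_sub (θ lam : ℝ) (v : Fin 4 × Fin 4 → ℂ) :
    expVal (witnessI θ - (lam : ℂ) • projPsi) v =
      (((2 - Real.sin θ / 2) * (Complex.normSq (v (0, 0)) + Complex.normSq (v (1, 1)) +
          Complex.normSq (v (2, 2)) + Complex.normSq (v (3, 3))) +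
        (1 + Real.cos θ) / 2 * (Complex.normSq (v (1, 0)) + Complex.normSq (v (2, 1)) +
          Complex.normSq (v (3, 2)) + Complex.normSq (v (0, 3))) +
        (1 + Real.sin θ / 2) * (Complex.normSq (v (2, 0)) + Complex.normSq (v (3, 1)) +
          Complex.normSq (v (0, 2)) + Complex.normSq (v (1, 3))) +
        (1 - Real.cos θ) / 2 * (Complex.normSq (v (3, 0)) + Complex.normSq (v (0, 1)) +
          Complex.normSq (v (1, 2)) + Complex.normSq (v (2, 3))) -
        Complex.normSq (v (0, 0) + v (1, 1) + v (2, 2) + v (3, 3)) -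
        lam / 4 * Complex.normSq (v (0, 0) - v (1, 1) + v (2, 2) - v (3, 3)) : ℝ) : ℂ) := by
  rw [expVal_sub, expVal_smul, expVal_projPsi, witnessI, expVal_circulantOp,
    ← Complex.ofReal_mul, ← Complex.ofReal_sub]
  congr 1
  have h : ∀ x y z w : ℝ,
      ![x, y, z, w] (0 - 0) = x ∧ ![x, y, z, w] (0 - 1) = w ∧ ![x, y, z, w] (0 - 2) = z ∧
      ![x, y, z, w] (0 - 3) = y ∧ ![x, y, z, w] (1 - 0) = y ∧ ![x, y, z, w] (1 - 1) = x ∧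
      ![x, y, z, w] (1 - 2) = w ∧ ![x, y, z, w] (1 - 3) = z ∧ ![x, y, z, w] (2 - 0) = z ∧
      ![x, y, z, w] (2 - 1) = y ∧ ![x, y, z, w] (2 - 2) = x ∧ ![x, y, z, w] (2 - 3) = w ∧
      ![x, y, z, w] (3 - 0) = w ∧ ![x, y, z, w] (3 - 1) = z ∧ ![x, y, z, w] (3 - 2) = y ∧
      ![x, y, z, w] (3 - 3) = x := by
    intro x y z w
    refine ⟨rfl, rfl, rfl, rfl, rfl, rfl, rfl, rfl, rfl, rfl, rfl, rfl, rfl, rfl, rfl, rfl⟩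
  simp only [Fin.sum_univ_four, h]
  ring

lemma isHermitian_witnessI_sub (θ lam : ℝ) :
    (witnessI θ - (lam : ℂ) • projPsi).IsHermitian := by
  refine Matrix.IsHermitian.sub ?_ ?_
  · ext p q
    rw [Matrix.conjTranspose_apply, witnessI, circulantOp_apply, circulantOp_apply]
    by_cases h : p = q
    · subst h; simp
    · have h' : ¬ q = p := fun e => h e.symm
      simp only [h, h', if_false]
      by_cases h1 : p.1 = p.2 <;> by_cases h2 : q.1 = q.2 <;> by_cases h3 : p.1 = q.1 <;>
        simp [h1, h2, h3, eq_comm]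
  · rw [Matrix.IsHermitian, Matrix.conjTranspose_smul, projPsi,
      (Matrix.posSemidef_vecMulVec_self_star bigPsi).isHermitian.eq]
    simp

/-- With u = z0 + z2 and v = z1 + z3 the left side is 3/2 |u|² + 3/2 |v|² + Re(u v̄), whose cross
term has a positive coefficient; the triangle inequality then removes all phases. The factor 1/2 is
λ/4 at λ = 2. -/
lemma normSq_add_add_half_normSq_sub_le (z0 z1 z2 z3 : ℂ) :
    Complex.normSq (z0 + z1 + z2 + z3) + 1 / 2 * Complex.normSq (z0 - z1 + z2 - z3) ≤
      3 / 2 * (‖z0‖ + ‖z2‖) ^ 2 + 3 / 2 * (‖z1‖ + ‖z3‖) ^ 2 +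
        (‖z0‖ + ‖z2‖) * (‖z1‖ + ‖z3‖) := by
  rw [show z0 + z1 + z2 + z3 = (z0 + z2) + (z1 + z3) by ring,
    show z0 - z1 + z2 - z3 = (z0 + z2) - (z1 + z3) by ring, Complex.normSq_add,
    Complex.normSq_sub]
  have hu := norm_add_le z0 z2
  have hv := norm_add_le z1 z3
  have hre : ((z0 + z2) * (starRingEnd ℂ) (z1 + z3)).re ≤ ‖z0 + z2‖ * ‖z1 + z3‖ := by
    refine (Complex.re_le_norm _).trans_eq ?_
    rw [norm_mul, Complex.norm_conj]
  rw [Complex.normSq_eq_norm_sq, Complex.normSq_eq_norm_sq]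
  have h1 := pow_le_pow_left₀ (norm_nonneg _) hu 2
  have h2 := pow_le_pow_left₀ (norm_nonneg _) hv 2
  have h3 := mul_le_mul hu hv (norm_nonneg _) (by positivity)
  linarith

/-! ### The threshold λ = 2. -/

lemma expVal_witnessI_sub_two_nonneg (θ : ℝ) (ψ φ : Fin 4 → ℂ) :
    0 ≤ (expVal (witnessI θ - ((2 : ℝ) : ℂ) • projPsi) (prodVec ψ φ)).re := by
  rw [expVal_witnessI_sub, Complex.ofReal_re]
  have h1 := normSq_add_add_half_normSq_sub_le (ψ 0 * φ 0) (ψ 1 * φ 1) (ψ 2 * φ 2) (ψ 3 * φ 3)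
  have h2 := circulant_form_ge (Real.sin θ) (Real.cos θ) (Real.sin_sq_add_cos_sq θ)
    ‖ψ 0‖ ‖ψ 1‖ ‖ψ 2‖ ‖ψ 3‖ ‖φ 0‖ ‖φ 1‖ ‖φ 2‖ ‖φ 3‖
  simp only [Complex.normSq_eq_norm_sq, norm_mul] at h1
  simp only [prodVec, Complex.normSq_eq_norm_sq, norm_mul, mul_pow] at h1 ⊢
  linarith

/-- The unnormalised diagonal vector `∑ j, |j ⊗ j⟩`. -/
def diagOnes : Fin 4 × Fin 4 → ℂ := fun p => if p.1 = p.2 then 1 else 0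

/-- `diagOnes` is orthogonal to `bigPsi`, so λ drops out and one vector excludes positivity for all
λ. -/
lemma expVal_diagOnes (θ lam : ℝ) :
    expVal (witnessI θ - (lam : ℂ) • projPsi) diagOnes = ((-8 - 2 * Real.sin θ : ℝ) : ℂ) := by
  rw [expVal_witnessI_sub]
  congr 1
  simp [diagOnes, Complex.normSq_apply]
  norm_num
  ring

lemma not_posSemidef_witnessI_sub (θ lam : ℝ) :
    ¬ (witnessI θ - (lam : ℂ) • projPsi).PosSemidef := fun h => by
  have h1 := (posSemidef_iff_expVal_re_nonneg h.isHermitian).1 h diagOnes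
  rw [expVal_diagOnes, Complex.ofReal_re] at h1
  linarith [Real.neg_one_le_sin θ]

lemma isEntanglementWitness_of_le_two (θ : ℝ) {lam : ℝ} (h : lam ≤ 2) :
    IsEntanglementWitness (witnessI θ - (lam : ℂ) • projPsi) := by
  refine ⟨isHermitian_witnessI_sub θ lam, fun ψ φ => ?_, not_posSemidef_witnessI_sub θ lam⟩
  refine (expVal_witnessI_sub_two_nonneg θ ψ φ).trans ?_
  simp only [expVal_sub, expVal_smul, expVal_projPsi, Complex.sub_re, Complex.re_ofReal_mul,
    Complex.ofReal_re]
  have := Complex.normSq_nonneg (prodVec ψ φ (0, 0) - prodVec ψ φ (1, 1) + prodVec ψ φ (2, 2) -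
    prodVec ψ φ (3, 3))
  nlinarith

lemma le_two_of_isEntanglementWitness {θ lam : ℝ}
    (h : IsEntanglementWitness (witnessI θ - (lam : ℂ) • projPsi)) : lam ≤ 2 := by
  -- The expectation value here is 2 - λ, whatever θ is.
  have h1 := h.2.1 ![1, 0, 1, 0] ![1, 0, 1, 0]
  rw [expVal_witnessI_sub, Complex.ofReal_re] at h1
  simp [prodVec, Complex.normSq_apply] at h1
  linarith

/-! ### Product zeros and the spanning property. -/

lemma expVal_flat (θ : ℝ) (ψ : Fin 4 → ℂ) (h02 : Complex.normSq (ψ 0) = Complex.normSq (ψ 2))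
    (h13 : Complex.normSq (ψ 1) = Complex.normSq (ψ 3)) :
    expVal (witnessI θ - ((2 : ℝ) : ℂ) • projPsi) (prodVec ψ (star ψ)) = 0 := by
  rw [expVal_witnessI_sub]
  have h : ∀ z : ℂ, z * (starRingEnd ℂ) z = ((Complex.normSq z : ℝ) : ℂ) := Complex.mul_conj
  simp only [prodVec, Pi.star_apply, Complex.star_def, h, Complex.normSq_mul,
    Complex.normSq_conj]
  rw [← Complex.ofReal_add, ← Complex.ofReal_add, ← Complex.ofReal_add, ← Complex.ofReal_sub,
    ← Complex.ofReal_add, ← Complex.ofReal_sub, Complex.normSq_ofReal, Complex.normSq_ofReal,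
    h02, h13, Complex.ofReal_eq_zero]
  simp only [Complex.normSq_ofReal]
  ring

/-- The product vectors supported on two neighbouring basis vectors. -/
lemma expVal_edge (θ x y : ℝ) :
    expVal (witnessI θ - ((2 : ℝ) : ℂ) • projPsi) (prodVec ![x, y, 0, 0] ![y, x, 0, 0]) =
        (((Real.cos (θ / 2) * y ^ 2 - Real.sin (θ / 2) * x ^ 2) ^ 2 : ℝ) : ℂ) ∧
      expVal (witnessI θ - ((2 : ℝ) : ℂ) • projPsi) (prodVec ![0, x, y, 0] ![0, y, x, 0]) =
        (((Real.cos (θ / 2) * y ^ 2 - Real.sin (θ / 2) * x ^ 2) ^ 2 : ℝ) : ℂ) := by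
  have hs : Real.sin θ = 2 * Real.sin (θ / 2) * Real.cos (θ / 2) := by
    rw [← Real.sin_two_mul]; congr 1; ring
  have hc : Real.cos θ = Real.cos (θ / 2) ^ 2 - Real.sin (θ / 2) ^ 2 := by
    rw [← Real.cos_two_mul']; congr 1; ring
  have h1 := Real.sin_sq_add_cos_sq (θ / 2)
  rw [expVal_witnessI_sub, expVal_witnessI_sub, hs, hc]
  set C := Real.cos (θ / 2)
  set S := Real.sin (θ / 2)
  constructor <;>
  · congr 1
    simp [prodVec, Complex.normSq_apply]
    linear_combination (-(x ^ 4 + y ^ 4) / 2) * h1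

/-- Polarization over phases: with unimodular entries ε at `k` and δ at `l`, the (k, l) entry of ψ ⊗
ψ̄ is ε δ̄. Signed sums over ε, δ = ±1 isolate |kl⟩ + |lk⟩, and those over ε = ±i, δ = ±1 isolate
|kl⟩ - |lk⟩. -/
lemma single_mem_of_flat_mem {S : Submodule ℂ (Fin 4 × Fin 4 → ℂ)}
    (hflat : ∀ ψ : Fin 4 → ℂ, Complex.normSq (ψ 0) = Complex.normSq (ψ 2) →
      Complex.normSq (ψ 1) = Complex.normSq (ψ 3) → prodVec ψ (star ψ) ∈ S)
    {k l : Fin 4} (hkl : k ≠ l) : Pi.single (k, l) 1 ∈ S := by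
  let ψ : ℂ → ℂ → Fin 4 → ℂ := fun ε δ j => if j = k then ε else if j = l then δ else 1
  let F : ℂ → ℂ → Fin 4 × Fin 4 → ℂ := fun ε δ => prodVec (ψ ε δ) (star (ψ ε δ))
  have hF : ∀ ε δ, Complex.normSq ε = 1 → Complex.normSq δ = 1 → F ε δ ∈ S := by
    intro ε δ hε hδ
    have h : ∀ j, Complex.normSq (ψ ε δ j) = 1 := fun j => by
      simp only [ψ]; split_ifs <;> simp [hε, hδ]
    exact hflat _ ((h 0).trans (h 2).symm) ((h 1).trans (h 3).symm)
  have key : (Pi.single (k, l) 1 : Fin 4 × Fin 4 → ℂ) =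
      (1 / 8 : ℂ) • (F 1 1 - F (-1) 1 - F 1 (-1) + F (-1) (-1)) -
        (Complex.I / 8) • (F Complex.I 1 - F (-Complex.I) 1 - F Complex.I (-1) +
          F (-Complex.I) (-1)) := by
    ext ⟨p, q⟩
    simp only [F, ψ, prodVec, Pi.single_apply, Prod.mk.injEq, Pi.sub_apply, Pi.add_apply,
      Pi.smul_apply, smul_eq_mul, Pi.star_apply]
    have hI := Complex.I_mul_I
    by_cases h1 : p = k
    · have h2 : ¬ p = l := fun e => hkl (h1.symm.trans e)
      by_cases h3 : q = k
      · have h4 : ¬ q = l := fun e => hkl (h3.symm.trans e)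
        simp only [h1, h3, hkl, if_true, if_false]
        simp
      · by_cases h4 : q = l
        · simp only [h1, h4, hkl.symm, if_true, if_false]
          simp
          linear_combination (1 / 2 : ℂ) * hI
        · simp only [h1, h3, h4, if_true, if_false]
          simp
    · by_cases h2 : p = l
      · by_cases h3 : q = k
        · simp only [h2, h3, hkl, hkl.symm, if_true, if_false]
          simp
          linear_combination (-1 / 2 : ℂ) * hI
        · by_cases h4 : q = l
          · simp only [h2, h4, hkl.symm, if_true, if_false]
            simp
          · simp only [h2, h3, h4, hkl.symm, if_true, if_false]
            simp
      · by_cases h3 : q = k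
        · simp only [h1, h2, h3, if_true, if_false]
          simp
        · by_cases h4 : q = l
          · simp only [h1, h2, h4, hkl.symm, if_true, if_false]
            simp
          · simp only [h1, h2, h3, h4, if_false]
            simp
  rw [key]
  have hI1 : Complex.normSq Complex.I = 1 := Complex.normSq_I
  have hI2 : Complex.normSq (-Complex.I) = 1 := by rw [Complex.normSq_neg, hI1]
  have h1 : Complex.normSq 1 = 1 := Complex.normSq_one
  have h2 : Complex.normSq (-1) = 1 := by rw [Complex.normSq_neg, h1]
  refine S.sub_mem (S.smul_mem _ ?_) (S.smul_mem _ ?_)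
  · exact S.add_mem (S.sub_mem (S.sub_mem (hF _ _ h1 h1) (hF _ _ h2 h1)) (hF _ _ h1 h2))
      (hF _ _ h2 h2)
  · exact S.add_mem (S.sub_mem (S.sub_mem (hF _ _ hI1 h1) (hF _ _ hI2 h1)) (hF _ _ hI1 h2))
      (hF _ _ hI2 h2)

lemma prodVec_edge (x y : ℂ) :
    prodVec ![x, y, 0, 0] ![y, x, 0, 0] =
        (x * y) • (Pi.single (0, 0) 1 + Pi.single (1, 1) 1) +
          ((x ^ 2) • Pi.single (0, 1) 1 + (y ^ 2) • Pi.single (1, 0) 1) ∧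
      prodVec ![0, x, y, 0] ![0, y, x, 0] =
        (x * y) • (Pi.single (1, 1) 1 + Pi.single (2, 2) 1) +
          ((x ^ 2) • Pi.single (1, 2) 1 + (y ^ 2) • Pi.single (2, 1) 1) := by
  constructor <;>
  · ext ⟨p, q⟩
    fin_cases p <;> fin_cases q <;> simp [prodVec] <;> ring

lemma eq_top_of_flat_mem {S : Submodule ℂ (Fin 4 × Fin 4 → ℂ)}
    (hflat : ∀ ψ : Fin 4 → ℂ, Complex.normSq (ψ 0) = Complex.normSq (ψ 2) →
      Complex.normSq (ψ 1) = Complex.normSq (ψ 3) → prodVec ψ (star ψ) ∈ S)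
    (h01 : Pi.single (0, 0) 1 + Pi.single (1, 1) 1 ∈ S)
    (h12 : Pi.single (1, 1) 1 + Pi.single (2, 2) 1 ∈ S) : S = ⊤ := by
  have hoff : ∀ k l : Fin 4, k ≠ l → Pi.single (k, l) 1 ∈ S := fun k l hkl =>
    single_mem_of_flat_mem hflat hkl
  have hsum : ∀ k l : Fin 4, k ≠ l →
      prodVec (Pi.single k 1 + Pi.single l 1) (star (Pi.single k 1 + Pi.single l 1)) ∈ S →
      (Pi.single (k, k) 1 + Pi.single (l, l) 1 : Fin 4 × Fin 4 → ℂ) ∈ S := by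
    intro k l hkl h
    convert S.sub_mem h (S.add_mem (hoff k l hkl) (hoff l k hkl.symm)) using 1
    ext ⟨p, q⟩
    have h1 : ∀ j, star ((if j = k then (1 : ℂ) else 0) + if j = l then 1 else 0) =
        (if j = k then (1 : ℂ) else 0) + if j = l then 1 else 0 := fun j => by
      split_ifs <;> simp
    simp only [prodVec, Pi.single_apply, Pi.add_apply, Pi.sub_apply, Pi.star_apply,
      Prod.mk.injEq, h1]
    by_cases hpk : p = k <;> by_cases hpl : p = l <;> by_cases hqk : q = k <;>
      by_cases hql : q = l <;> simp_all
  have h02 := hsum 0 2 (by decide) (hflat _ (by simp) (by simp))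
  have h13 := hsum 1 3 (by decide) (hflat _ (by simp) (by simp))
  have h0 : Pi.single (0, 0) 1 ∈ S := by
    convert S.smul_mem (1 / 2 : ℂ) (S.add_mem (S.sub_mem h01 h12) h02) using 1
    module
  have h1 : Pi.single (1, 1) 1 ∈ S := by simpa using S.sub_mem h01 h0
  have h2 : Pi.single (2, 2) 1 ∈ S := by simpa using S.sub_mem h02 h0
  have h3 : Pi.single (3, 3) 1 ∈ S := by simpa using S.sub_mem h13 h1
  have hall : ∀ p : Fin 4 × Fin 4, Pi.single p 1 ∈ S := by
    rintro ⟨k, l⟩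
    by_cases hkl : k = l
    · subst hkl
      fin_cases k
      exacts [h0, h1, h2, h3]
    · exact hoff k l hkl
  rw [Submodule.eq_top_iff']
  intro v
  rw [pi_eq_sum_univ' v]
  refine S.sum_mem fun p _ => S.smul_mem _ ?_
  convert hall p using 1

theorem hasSpanningProperty_witnessI_sub_two {θ : ℝ} (hθ : θ ∈ Set.Ioo 0 Real.pi) :
    HasSpanningProperty (witnessI θ - ((2 : ℝ) : ℂ) • projPsi) := by
  have hS : 0 < Real.sin (θ / 2) :=
    Real.sin_pos_of_pos_of_lt_pi (by linarith [hθ.1]) (by linarith [hθ.1, hθ.2])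
  have hC : 0 < Real.cos (θ / 2) :=
    Real.cos_pos_of_mem_Ioo ⟨by linarith [hθ.1, Real.pi_pos], by linarith [hθ.2]⟩
  set S := Submodule.span ℂ {v : Fin 4 × Fin 4 → ℂ | ∃ ψ φ : Fin 4 → ℂ,
    v = prodVec ψ φ ∧ expVal (witnessI θ - ((2 : ℝ) : ℂ) • projPsi) v = 0} with hSdef
  have hmem : ∀ ψ φ : Fin 4 → ℂ,
      expVal (witnessI θ - ((2 : ℝ) : ℂ) • projPsi) (prodVec ψ φ) = 0 → prodVec ψ φ ∈ S :=
    fun ψ φ h => Submodule.subset_span ⟨ψ, φ, rfl, h⟩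
  have hflat : ∀ ψ : Fin 4 → ℂ, Complex.normSq (ψ 0) = Complex.normSq (ψ 2) →
      Complex.normSq (ψ 1) = Complex.normSq (ψ 3) → prodVec ψ (star ψ) ∈ S :=
    fun ψ h02 h13 => hmem _ _ (expVal_flat θ ψ h02 h13)
  have hoff : ∀ k l : Fin 4, k ≠ l → Pi.single (k, l) 1 ∈ S := fun k l hkl =>
    single_mem_of_flat_mem hflat hkl
  -- This choice annihilates C y² - S x²; both roots are nonzero because θ is interior.
  set x := √(Real.cos (θ / 2)) with hx
  set y := √(Real.sin (θ / 2)) with hy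
  have hxy : (x : ℂ) * y ≠ 0 := mul_ne_zero
    (Complex.ofReal_ne_zero.2 (Real.sqrt_ne_zero'.2 hC))
    (Complex.ofReal_ne_zero.2 (Real.sqrt_ne_zero'.2 hS))
  have hzero : (Real.cos (θ / 2) * y ^ 2 - Real.sin (θ / 2) * x ^ 2) ^ 2 = 0 := by
    rw [hx, hy, Real.sq_sqrt hC.le, Real.sq_sqrt hS.le]; ring
  obtain ⟨e1, e2⟩ := expVal_edge θ x y
  obtain ⟨p1, p2⟩ := prodVec_edge x y
  rw [hzero, Complex.ofReal_zero] at e1 e2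
  have m1 := hmem _ _ e1
  have m2 := hmem _ _ e2
  rw [p1, S.add_mem_iff_left (S.add_mem (S.smul_mem _ (hoff _ _ (by decide)))
    (S.smul_mem _ (hoff _ _ (by decide)))), S.smul_mem_iff hxy] at m1
  rw [p2, S.add_mem_iff_left (S.add_mem (S.smul_mem _ (hoff _ _ (by decide)))
    (S.smul_mem _ (hoff _ _ (by decide)))), S.smul_mem_iff hxy] at m2
  exact eq_top_of_flat_mem hflat m1 m2

/-! ### Optimality of W_I(θ) - 2P. -/

lemma expVal_smul_add_of_mulVec_eq_zero {ι : Type*} [Fintype ι] {Q : Matrix ι ι ℂ}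
    (hQ : Q.IsHermitian) (a : ℂ) (w : ι → ℂ) {u : ι → ℂ} (hu : Q *ᵥ u = 0) :
    expVal Q (a • w + u) = Complex.normSq a * expVal Q w := by
  have h : star u ⬝ᵥ (Q *ᵥ w) = 0 := by
    rw [Matrix.dotProduct_mulVec, ← hQ.eq, ← Matrix.star_mulVec, hu, star_zero, zero_dotProduct]
  simp only [expVal, Matrix.mulVec_add, hu, add_zero, Matrix.mulVec_smul, star_add, star_smul,
    add_dotProduct, dotProduct_smul, smul_dotProduct, h, smul_eq_mul,
    Complex.normSq_eq_conj_mul_self, Complex.star_def]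
  ring

lemma eq_zero_of_forall_mul_le {C S e lam : ℝ} (hC : 0 ≤ C) (hS : 0 ≤ S) (h1 : S ^ 2 + C ^ 2 = 1)
    (he : 0 ≤ e) (h : ∀ x y : ℝ, x ^ 2 * y ^ 2 * e ≤ lam * (C * y ^ 2 - S * x ^ 2) ^ 2) :
    e = 0 := by
  refine le_antisymm ?_ he
  have hlim : ∀ δ : ℝ, 0 < δ → e ≤ |lam| * δ := by
    intro δ hδ
    -- Near the zero x² : y² = C : S the right side is O(δ²), while x² y² ≥ δ since C + S ≥ 1. This
    -- also covers C = 0 or S = 0, where the exact zero has xy = 0 and gives no information.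
    have h2 := h (√(C + δ)) (√(S + δ))
    rw [Real.sq_sqrt (by positivity), Real.sq_sqrt (by positivity)] at h2
    have h3 : lam * (C * (S + δ) - S * (C + δ)) ^ 2 ≤ |lam| * δ ^ 2 := by
      have h5 : (C * (S + δ) - S * (C + δ)) ^ 2 ≤ δ ^ 2 := by
        have : (C * (S + δ) - S * (C + δ)) ^ 2 = δ ^ 2 * (1 - 2 * (C * S)) := by
          linear_combination δ ^ 2 * h1
        rw [this]
        have h6 : 0 ≤ δ ^ 2 * (C * S) := by positivity
        linarith
      exact (mul_le_mul_of_nonneg_right (le_abs_self lam) (sq_nonneg _)).trans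
        (mul_le_mul_of_nonneg_left h5 (abs_nonneg _))
    have h4 : 1 ≤ C + S := by nlinarith [mul_nonneg hC hS]
    have h7 : δ * e ≤ (C + δ) * (S + δ) * e := by
      refine mul_le_mul_of_nonneg_right ?_ he
      nlinarith [mul_nonneg hC hS]
    have h8 : δ * e ≤ δ * (|lam| * δ) := by linarith
    exact le_of_mul_le_mul_left h8 hδ
  refine le_of_forall_pos_le_add fun ε hε => ?_
  have h2 := hlim (ε / (|lam| + 1)) (by positivity)
  have h3 : |lam| * (ε / (|lam| + 1)) ≤ ε := by
    rw [mul_div_assoc', div_le_iff₀ (by positivity)]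
    nlinarith
  linarith

theorem isOptimalWitness_witnessI_sub_two {θ : ℝ} (hθ : θ ∈ Set.Icc 0 Real.pi) :
    IsOptimalWitness (witnessI θ - ((2 : ℝ) : ℂ) • projPsi) := by
  have hS : 0 ≤ Real.sin (θ / 2) :=
    Real.sin_nonneg_of_nonneg_of_le_pi (by linarith [hθ.1]) (by linarith [hθ.1, hθ.2])
  have hC : 0 ≤ Real.cos (θ / 2) :=
    Real.cos_nonneg_of_mem_Icc ⟨by linarith [hθ.1, Real.pi_pos], by linarith [hθ.2]⟩
  refine ⟨isEntanglementWitness_of_le_two θ le_rfl, fun W' hW' hss => ?_⟩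
  set W := witnessI θ - ((2 : ℝ) : ℂ) • projPsi with hW
  obtain ⟨lam, hlam, hQ⟩ := exists_posSemidef_smul_sub (isHermitian_witnessI_sub θ 2) hW'.1
    (not_posSemidef_witnessI_sub θ 2) hss.1
  set Q := (lam : ℂ) • W - W' with hQdef
  have hQle : ∀ ψ φ, (expVal Q (prodVec ψ φ)).re ≤ lam * (expVal W (prodVec ψ φ)).re := by
    intro ψ φ
    rw [hQdef, expVal_sub, expVal_smul, Complex.sub_re, Complex.re_ofReal_mul]
    linarith [hW'.2.1 ψ φ]
  have hQ0 : ∀ v, 0 ≤ (expVal Q v).re := (posSemidef_iff_expVal_re_nonneg hQ.isHermitian).1 hQ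
  have hker : ∀ v, (expVal Q v).re = 0 → v ∈ LinearMap.ker Q.mulVecLin := by
    intro v hv
    rw [LinearMap.mem_ker, Matrix.mulVecLin_apply, ← hQ.dotProduct_mulVec_zero_iff]
    exact Complex.ext hv (expVal_im_eq_zero hQ.isHermitian v)
  have hflat : ∀ ψ : Fin 4 → ℂ, Complex.normSq (ψ 0) = Complex.normSq (ψ 2) →
      Complex.normSq (ψ 1) = Complex.normSq (ψ 3) →
        prodVec ψ (star ψ) ∈ LinearMap.ker Q.mulVecLin := by
    intro ψ h02 h13
    refine hker _ (le_antisymm ?_ (hQ0 _))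
    have := hQle ψ (star ψ)
    rwa [hW, expVal_flat θ ψ h02 h13, Complex.zero_re, mul_zero] at this
  have hoff : ∀ (a b : ℂ) (k l k' l' : Fin 4), k ≠ l → k' ≠ l' →
      Q *ᵥ (a • Pi.single (k, l) 1 + b • Pi.single (k', l') 1) = 0 := fun a b k l k' l' h h' =>
    LinearMap.mem_ker.1 (Submodule.add_mem _
      (Submodule.smul_mem _ _ (single_mem_of_flat_mem hflat h))
      (Submodule.smul_mem _ _ (single_mem_of_flat_mem hflat h')))
  have hre : ∀ (x y : ℝ) (w u : Fin 4 × Fin 4 → ℂ), Q *ᵥ u = 0 →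
      (expVal Q (((x : ℂ) * y) • w + u)).re = x ^ 2 * y ^ 2 * (expVal Q w).re := by
    intro x y w u hu
    rw [expVal_smul_add_of_mulVec_eq_zero hQ.isHermitian _ _ hu, Complex.re_ofReal_mul,
      ← Complex.ofReal_mul, Complex.normSq_ofReal]
    ring
  -- The off-diagonal part of the edge vector lies in the kernel of `Q`, so only x² y² times the
  -- value at the diagonal part survives.
  have h01 := hker (Pi.single (0, 0) 1 + Pi.single (1, 1) 1)
    (eq_zero_of_forall_mul_le (lam := lam) hC hS (Real.sin_sq_add_cos_sq _) (hQ0 _) fun x y => by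
      have := hQle ![x, y, 0, 0] ![y, x, 0, 0]
      rwa [hW, (expVal_edge θ x y).1, (prodVec_edge x y).1, Complex.ofReal_re,
        hre _ _ _ _ (hoff _ _ _ _ _ _ (by decide) (by decide))] at this)
  have h12 := hker (Pi.single (1, 1) 1 + Pi.single (2, 2) 1)
    (eq_zero_of_forall_mul_le (lam := lam) hC hS (Real.sin_sq_add_cos_sq _) (hQ0 _) fun x y => by
      have := hQle ![0, x, y, 0] ![0, y, x, 0]
      rwa [hW, (expVal_edge θ x y).2, (prodVec_edge x y).2, Complex.ofReal_re,
        hre _ _ _ _ (hoff _ _ _ _ _ _ (by decide) (by decide))] at this)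
  have hQzero : Q = 0 := by
    have h := LinearMap.ker_eq_top.1 (eq_top_of_flat_mem hflat h01 h12)
    exact Matrix.mulVec_injective (funext fun v => by
      rw [Matrix.zero_mulVec, ← Matrix.mulVecLin_apply, h, LinearMap.zero_apply])
  refine hss.2 fun ρ hρ => ⟨hρ.1, ?_⟩
  have h := hρ.2
  rw [← sub_eq_zero.1 hQzero, Matrix.smul_mul, Matrix.trace_smul, smul_eq_mul,
    Complex.re_ofReal_mul] at h
  exact neg_of_mul_neg_right h hlam

/-! ### Non-optimality of W_I(θ). -/

lemma expVal_bigPsi (θ lam : ℝ) :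
    expVal (witnessI θ - (lam : ℂ) • projPsi) bigPsi = ((2 - Real.sin θ / 2 - lam : ℝ) : ℂ) := by
  rw [expVal_witnessI_sub]
  congr 1
  simp [bigPsi, Complex.normSq_apply]
  norm_num

theorem not_isOptimalWitness_witnessI (θ : ℝ) : ¬ IsOptimalWitness (witnessI θ) := by
  intro hopt
  refine hopt.2 _ (isEntanglementWitness_of_le_two θ le_rfl) ⟨fun ρ hρ => ⟨hρ.1, ?_⟩, fun h => ?_⟩
  · have h1 : 0 ≤ (projPsi * ρ).trace.re := by
      rw [Matrix.trace_mul_comm, projPsi, trace_mul_vecMulVec_star]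
      exact (posSemidef_iff_expVal_re_nonneg hρ.1.1.isHermitian).1 hρ.1.1 bigPsi
    rw [sub_mul, Matrix.trace_sub, Complex.sub_re, Matrix.smul_mul, Matrix.trace_smul,
      smul_eq_mul, Complex.re_ofReal_mul]
    linarith [hρ.2]
  · have hs1 := Real.neg_one_le_sin θ
    have hs2 := Real.sin_le_one θ
    set s := Real.sin θ with hs
    -- The weights give trace one and Tr(W_I(θ) ρ) = 0, so `ρ` escapes W_I(θ), but its overlap with
    -- P lets W_I(θ) - 2P detect it.
    let ρ : Matrix (Fin 4 × Fin 4) (Fin 4 × Fin 4) ℂ :=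
      (((4 + s) / 8 : ℝ) : ℂ) • Matrix.vecMulVec bigPsi (star bigPsi) +
        (((4 - s) / 32 : ℝ) : ℂ) • Matrix.vecMulVec diagOnes (star diagOnes)
    have htr : ∀ lam : ℝ, ((witnessI θ - (lam : ℂ) • projPsi) * ρ).trace.re =
        - ((4 + s) / 8 * lam) := by
      intro lam
      simp only [ρ]
      rw [mul_add, Matrix.mul_smul, Matrix.mul_smul, Matrix.trace_add, Matrix.trace_smul,
        Matrix.trace_smul, trace_mul_vecMulVec_star, trace_mul_vecMulVec_star, expVal_bigPsi,
        expVal_diagOnes, smul_eq_mul, smul_eq_mul, Complex.add_re, Complex.re_ofReal_mul,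
        Complex.re_ofReal_mul, Complex.ofReal_re, Complex.ofReal_re, ← hs]
      ring
    have hstate : IsState ρ := by
      refine ⟨?_, ?_⟩
      · exact ((Matrix.posSemidef_vecMulVec_self_star _).smul
          (Complex.zero_le_real.2 (by linarith))).add
          ((Matrix.posSemidef_vecMulVec_self_star _).smul
          (Complex.zero_le_real.2 (by linarith)))
      · simp only [ρ]
        rw [Matrix.trace_add, Matrix.trace_smul, Matrix.trace_smul, Matrix.trace_vecMulVec,
          Matrix.trace_vecMulVec]
        have e1 : bigPsi ⬝ᵥ star bigPsi = 1 := by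
          simp [dotProduct, Fintype.sum_prod_type, bigPsi, Fin.sum_univ_four, Complex.conj_ofNat]
          norm_num
        have e2 : diagOnes ⬝ᵥ star diagOnes = 4 := by
          simp [dotProduct, Fintype.sum_prod_type, diagOnes]
        rw [e1, e2]
        push_cast
        simp only [smul_eq_mul]
        ring
    have h2 := (h ⟨hstate, by rw [htr]; linarith⟩).2
    have h0 := htr 0
    rw [Complex.ofReal_zero, zero_smul, sub_zero] at h0
    rw [h0] at h2
    linarith

end BellWitness

end

theorem theorem1 (θ : ℝ) (hθ : θ ∈ Set.Icc 0 Real.pi) :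
    (∀ lam : ℝ, BellWitness.IsEntanglementWitness
        (BellWitness.witnessI θ - (lam : ℂ) • BellWitness.projPsi) ↔ lam ≤ 2) ∧
      BellWitness.IsOptimalWitness (BellWitness.witnessI θ - (2 : ℂ) • BellWitness.projPsi) ∧
      ¬ BellWitness.IsOptimalWitness (BellWitness.witnessI θ) ∧
      (θ ∈ Set.Ioo 0 Real.pi → BellWitness.HasSpanningProperty
        (BellWitness.witnessI θ - (2 : ℂ) • BellWitness.projPsi)) := by
  have h2 : (2 : ℂ) = ((2 : ℝ) : ℂ) := by norm_num
  rw [h2]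
  exact ⟨fun lam => ⟨BellWitness.le_two_of_isEntanglementWitness,
      BellWitness.isEntanglementWitness_of_le_two θ⟩,
    BellWitness.isOptimalWitness_witnessI_sub_two hθ,
    BellWitness.not_isOptimalWitness_witnessI θ,
    BellWitness.hasSpanningProperty_witnessI_sub_two⟩
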